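/- Let $A$ be a finite alphabet. A \emph{shift} over $A$ is a non-empty closed subset $\mathcal X\subseteq A^{\mathbb Z}$ (product of discrete topologies) with $\sigma(\mathcal X)=\mathcal X$, where $\sigma((x_i)_i)=(x_{i+1})_i$; $L(\mathcal X)$ is the set of its non-empty finite blocks. Two shifts are conjugate if there is a homeomorphism between them commuting with $\sigma$. Given a letter $\alpha\in A$ and a letter $\diamond\notin A$, the symbol expansion of $\mathcal X$ relative to $\alpha$ is the least subshift $\mathcal X'$ of $(A\cup\{\diamond\})^{\mathbb Z}$ such that $L(\mathcal X')$ contains $\mathcal E(L(\mathcal X))$, where $\mathcal E$ is the monoid homomorphism $A^*\to (A\cup\{\diamond\})^*$ with $\mathcal E(\alpha)=\alpha\diamond$ and $\mathcal E(a)=a$ for $a\in A\setminus\{\alpha\}$. \emph{Flow equivalence} is the least equivalence relation between shifts containing conjugacy and symbol expansion. Let $A^+_0=A^+\cup\{0\}$ be the free semigroup on $A$ with a zero adjoined. The \emph{syntactic semigroup} $S(\mathcal X)$ is the quotient of $A^+_0$ by the congruence identifying $u$ and $v$ when $[u]=[v]$, where $[u]=\{(x,y)\in A^*\times A^*: xuy\in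 L(\mathcal X)\}$ for $u\in A^+$ and $[0]=\emptyset$. The \emph{Karoubi envelope} $\mathbb K(S)$ of a semigroup $S$ is the category whose objects are the idempotents of $S$ and whose morphisms from $f$ to $e$ are the triples $(e,s,f)$ with $s\in eSf$, with composition $(e,s,f)(f,t,g)=(e,st,g)$; put $\mathbb K(\mathcal X)=\mathbb K(S(\mathcal X))$. Semigroups $S$ and $T$ are \emph{Morita equivalent up to local units} if $\mathbb K(S)$ and $\mathbb K(T)$ are equivalent categories. An assignment $S\mapsto F(S)$ of an object of a category $C$ to each semigroup $S$ is a \emph{Karoubi invariant} if $F(S)\cong F(T)$ whenever $\mathbb K(S)$ and $\mathbb K(T)$ are equivalent. \textbf{Theorem.} If $\mathcal X$ and $\mathcal Y$ are flow equivalent shifts, then the categories $\mathbb K(\mathcal X)$ and $\mathbb K(\mathcal Y)$ are equivalent, i.e., $S(\mathcal X)$ and $S(\mathcal Y)$ are Morita equivalent up to local units. Hence every Karoubi invariant of $S(\mathcal X)$ is a flow equivalence invariant of $\mathcal X$: if $F$ is a Karoubi invariant, then $F(S(\mathcal X))\cong F(S(\mathcal Y))$ whenever $\mathcal X$ and $\mathcal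 Y$ are flow equivalent. -/

import Mathlib

open CategoryTheory SymbolicDynamics.FullShift

universe u v w

namespace KaroubiShift

section Semigroups

/-- The objects of the Karoubi envelope of a semigroup `S`: the idempotents of `S`. -/
structure KaroubiEnvelope (S : Type u) [Semigroup S] : Type u where
  /-- the idempotent -/
  e : S
  idem : e * e = e

/-- The Karoubi envelope of a semigroup. A morphism `f ⟶ e` is an element `s ∈ eSf`, that is, an
`s` with `s = e s f`. The composite of `t : g ⟶ f` and `s : f ⟶ e` is `s t : g ⟶ e`, and the
identity at `e` is `e`. -/
instance karoubiCategory (S : Type u) [Semigroup S] : SmallCategory (KaroubiEnvelope S) where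
  Hom f e := {s : S // e.e * s * f.e = s}
  id e := ⟨e.e, by rw [e.idem, e.idem]⟩
  comp {g f e} t s := ⟨s.1 * t.1, by
    have h1 : e.e * s.1 = s.1 := by
      rw [← s.2, ← mul_assoc, ← mul_assoc, e.idem]
    have h2 : t.1 * g.e = t.1 := by
      rw [← t.2, mul_assoc, g.idem]
    rw [← mul_assoc, h1, mul_assoc, h2]⟩
  id_comp {f e} s := Subtype.ext (by
    change s.1 * f.e = s.1
    rw [← s.2, mul_assoc, f.idem])
  comp_id {f e} s := Subtype.ext (by
    change e.e * s.1 = s.1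
    rw [← s.2, ← mul_assoc, ← mul_assoc, e.idem])
  assoc r s t := Subtype.ext (mul_assoc t.1 s.1 r.1).symm

/-- Semigroups `S` and `T` are Morita equivalent up to local units if their Karoubi envelopes are
equivalent categories. -/
def MoritaEquivalentUpToLocalUnits (S T : Type u) [Semigroup S] [Semigroup T] : Prop :=
  Nonempty (KaroubiEnvelope S ≌ KaroubiEnvelope T)

/-- An assignment `S ↦ F S` of an object of a category `C` to each semigroup `S` is a Karoubi
invariant if `F S ≅ F T` whenever the Karoubi envelopes of `S` and `T` are equivalent. -/
def IsKaroubiInvariant {C : Type v} [Category.{w} C] (F : (S : Type u) → [Semigroup S] → C) :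
    Prop :=
  ∀ (S T : Type u) [Semigroup S] [Semigroup T],
    Nonempty (KaroubiEnvelope S ≌ KaroubiEnvelope T) → Nonempty (F S ≅ F T)

end Semigroups

section Syntactic

variable {A : Type u}

/-- The list of letters of an element of the free semigroup `A⁺`. -/
def word (u : FreeSemigroup A) : List A := u.head :: u.tail

theorem word_mul (u v : FreeSemigroup A) : word (u * v) = word u ++ word v := rfl

/-- The context in `L` of an element `u` of `A⁺ ∪ {0}`: the set of pairs `(x, y)` of (possibly
empty) words such that `u ≠ 0` and `xuy ∈ L`. -/
def context (L : Language A) (u : WithZero (FreeSemigroup A)) : Set (List A × List A) :=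
  {p | ∃ a : FreeSemigroup A, u = a ∧ p.1 ++ word a ++ p.2 ∈ L}

theorem context_mul_subset (L : Language A) {u u' v v' : WithZero (FreeSemigroup A)}
    (hu : context L u = context L u') (hv : context L v = context L v') :
    context L (u * v) ⊆ context L (u' * v') := by
  rintro ⟨x, y⟩ ⟨c, hc, hL⟩
  induction u using WithZero.recZeroCoe with
  | zero => simp at hc
  | coe a =>
  induction v using WithZero.recZeroCoe with
  | zero => simp at hc
  | coe b =>
  have hc' : a * b = c := by
    rw [← WithZero.coe_mul] at hc
    exact WithZero.coe_injective hc
  subst hc'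
  have h1 : (x, word b ++ y) ∈ context L (a : WithZero (FreeSemigroup A)) :=
    ⟨a, rfl, by simpa [word_mul] using hL⟩
  rw [hu] at h1
  obtain ⟨a', rfl, h1⟩ := h1
  have h2 : (x ++ word a', y) ∈ context L (b : WithZero (FreeSemigroup A)) :=
    ⟨b, rfl, by simpa using h1⟩
  rw [hv] at h2
  obtain ⟨b', rfl, h2⟩ := h2
  exact ⟨a' * b', (WithZero.coe_mul a' b').symm, by simpa [word_mul] using h2⟩

/-- The syntactic congruence of a language `L` on the free semigroup with zero `A⁺ ∪ {0}`. -/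
def syntacticCon (L : Language A) : Con (WithZero (FreeSemigroup A)) where
  r u v := context L u = context L v
  iseqv := ⟨fun _ => rfl, fun h => h.symm, fun h h' => h.trans h'⟩
  mul' h h' := Set.Subset.antisymm (context_mul_subset L h h') (context_mul_subset L h.symm h'.symm)

/-- The syntactic semigroup (with zero) of a language. -/
abbrev SyntacticSemigroup (L : Language A) : Type u := (syntacticCon L).Quotient

end Syntactic

section Shifts

/-- The set of blocks `x i, x (i+1), …, x (i+n)` (`i ∈ ℤ`, `n ≥ 0`) of elements of a set of
bi-infinite sequences. -/
def blocks {A : Type u} (X : Set (ℤ → A)) : Language A :=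
  {l | ∃ x ∈ X, ∃ (i : ℤ) (n : ℕ), l = (List.range (n + 1)).map fun k : ℕ => x (i + k)}

/-- A shift: a non-empty closed shift-invariant set of bi-infinite sequences over a finite
(discrete) alphabet. -/
structure Shift where
  /-- the alphabet -/
  Alphabet : Type u
  [finite : Finite Alphabet]
  [topology : TopologicalSpace Alphabet]
  [discrete : DiscreteTopology Alphabet]
  /-- the closed invariant set of sequences -/
  toSubshift : Subshift Alphabet ℤ
  nonempty : toSubshift.carrier.Nonempty

attribute [instance] Shift.finite Shift.topology Shift.discrete

namespace Shift

/-- The points of a shift, with the topology induced by the product topology. -/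
abbrev Point (X : Shift.{u}) : Type u := X.toSubshift.carrier

/-- The shift map `(x i) ↦ (x (i+1))` on the points of a shift. -/
def map (X : Shift.{u}) (x : X.Point) : X.Point :=
  ⟨fun i => x.1 (i + 1), by
    have h := X.toSubshift.mapsTo 1 x.2
    have e : (fun i : ℤ => x.1 (i + 1)) = shift 1 x.1 := by
      funext i
      rw [shift_apply, add_comm]
    rw [e]
    exact h⟩

/-- The language of a shift. -/
def language (X : Shift.{u}) : Language X.Alphabet := blocks X.toSubshift.carrier

/-- The syntactic semigroup of a shift. -/
abbrev syntacticSemigroup (X : Shift.{u}) : Type u := SyntacticSemigroup X.language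

/-- The Karoubi envelope of a shift. -/
abbrev karoubi (X : Shift.{u}) : Type u := KaroubiEnvelope X.syntacticSemigroup

/-- Two shifts are conjugate if there is a homeomorphism between them that commutes with the
shift maps. -/
def Conjugate (X Y : Shift.{u}) : Prop :=
  ∃ Φ : X.Point ≃ₜ Y.Point, ∀ x, Φ (X.map x) = Y.map (Φ x)

open Classical in
/-- The monoid homomorphism from words over `A` to words over `B = A ∪ {⋄}` (the identification is
`e`, and `none` stands for the new letter `⋄`) that sends the letter `α` to `α⋄` and fixes every
other letter. -/
noncomputable def expandWord {A B : Type u} (e : Option A ≃ B) (α : A) (l : List A) : List B :=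
  l.flatMap fun a => if a = α then [e (some a), e none] else [e (some a)]

/-- `Y` is a symbol expansion of `X`: for some letter `α`, and with the alphabet of `Y` identified
with that of `X` together with one new letter `⋄`, `Y` is the least subshift whose language
contains the words obtained from those of the language of `X` by the substitution `α ↦ α⋄`. -/
def IsSymbolExpansion (X Y : Shift.{u}) : Prop :=
  ∃ (e : Option X.Alphabet ≃ Y.Alphabet) (α : X.Alphabet),
    (∀ l ∈ X.language, expandWord e α l ∈ Y.language) ∧
    ∀ Z : Subshift Y.Alphabet ℤ, (∀ l ∈ X.language, expandWord e α l ∈ blocks Z.carrier) →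
      Y.toSubshift.carrier ⊆ Z.carrier

/-- Flow equivalence: the least equivalence relation between shifts that contains conjugacy and
symbol expansion. -/
def FlowEquivalent : Shift.{u} → Shift.{u} → Prop :=
  Relation.EqvGen fun X Y => Conjugate X Y ∨ IsSymbolExpansion X Y

end Shift

end Shifts

end KaroubiShift

/-! Conjugacy and symbol expansion are both handled by one kind of map: a nonerasing morphism `h`
between languages that is recognizable (`IsRecognizable`), meaning that an occurrence of `h(awb)` in
an image forces an occurrence of `w` as soon as the margins `a`, `b` have length at least `k`. Such
a morphism makes the Karoubi envelopes equivalent (`IsRecognizable.nonempty_equivalence`), although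
it need not induce a homomorphism of syntactic semigroups.

Idempotents supply the margins. An idempotent class has arbitrarily long representatives, and if `w`
represents a morphism from the class of `v` to that of `u`, then `uwv` has the same class as `w`.
The functor sends `w` to the class of `h(uwv)`. Long margins make it well defined and multiplicative
(`imageClass_mul`); transporting contexts back along `h` makes it faithful and full; and an
idempotent `or` of the target whose rotation `ro` is an image `h(t)` is isomorphic to the image of
the class of `tt`, which makes it essentially surjective (`exists_obj_iso`).

For a conjugacy, the pairs of a point and its image form a shift-invariant compact set over the
product alphabet. Both coordinate projections are injective on it, hence recognizable by compactness
(`exists_window`), so both envelopes are equivalent to a third one. For a symbol expansion, the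
substitution itself is recognizable because every letter other than the new one begins the image of
a letter (`exists_cut`). -/

namespace KaroubiShift

/-! ### Syntactic classes of words in factorial languages. -/

section FactorialLanguages

variable {A : Type u}

/-- A language of non-empty words that contains the non-empty factors of its elements. -/
structure IsFactorial (L : Language A) : Prop where
  nil_notMem : [] ∉ L
  mem_of_append : ∀ {x w y : List A}, x ++ w ++ y ∈ L → w ≠ [] → w ∈ L

/-- Every element of the language extends in it, arbitrarily far, on both sides. -/
def IsProlongable (L : Language A) : Prop :=
  ∀ w ∈ L, ∀ n : ℕ, ∃ p q : List A, n ≤ p.length ∧ n ≤ q.length ∧ p ++ w ++ q ∈ L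

theorem IsFactorial.ne_nil {L : Language A} (hL : IsFactorial L) {w : List A} (hw : w ∈ L) :
    w ≠ [] := by
  rintro rfl
  exact hL.nil_notMem hw

/-- The class of a word in the syntactic semigroup; the empty word is sent to zero. -/
def syntacticClass (L : Language A) : List A → SyntacticSemigroup L
  | [] => ((0 : WithZero (FreeSemigroup A)) : (syntacticCon L).Quotient)
  | a :: l => (((⟨a, l⟩ : FreeSemigroup A) : WithZero (FreeSemigroup A)) :
      (syntacticCon L).Quotient)

variable {L : Language A}

theorem syntacticClass_nil_mul (s : SyntacticSemigroup L) :
    syntacticClass L [] * s = syntacticClass L [] := by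
  induction s using Con.induction_on with
  | H s => exact congrArg _ (zero_mul s)

theorem mul_syntacticClass_nil (s : SyntacticSemigroup L) :
    s * syntacticClass L [] = syntacticClass L [] := by
  induction s using Con.induction_on with
  | H s => exact congrArg _ (mul_zero s)

theorem syntacticClass_append {v w : List A} (hv : v ≠ []) (hw : w ≠ []) :
    syntacticClass L (v ++ w) = syntacticClass L v * syntacticClass L w := by
  cases v with
  | nil => exact absurd rfl hv
  | cons a v =>
  cases w with
  | nil => exact absurd rfl hw
  | cons b w => rfl

theorem mem_context_coe {a : FreeSemigroup A} {x y : List A} :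
    (x, y) ∈ context L (a : WithZero (FreeSemigroup A)) ↔ x ++ word a ++ y ∈ L := by
  constructor
  · rintro ⟨b, hb, h⟩
    obtain rfl := WithZero.coe_injective hb
    exact h
  · exact fun h => ⟨a, rfl, h⟩

theorem context_zero : context L (0 : WithZero (FreeSemigroup A)) = ∅ := by
  ext ⟨x, y⟩
  simp [context]

theorem syntacticClass_eq_iff {v w : List A} (hv : v ≠ []) (hw : w ≠ []) :
    syntacticClass L v = syntacticClass L w ↔ ∀ x y, x ++ v ++ y ∈ L ↔ x ++ w ++ y ∈ L := by
  cases v with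
  | nil => exact absurd rfl hv
  | cons a v =>
  cases w with
  | nil => exact absurd rfl hw
  | cons b w =>
  refine (Con.eq (syntacticCon L)).trans ⟨fun h x y => ?_, fun h => ?_⟩
  · have h' := Set.ext_iff.1 (show context L _ = context L _ from h) (x, y)
    rwa [mem_context_coe, mem_context_coe] at h'
  · refine Set.ext fun ⟨x, y⟩ => ?_
    rw [mem_context_coe, mem_context_coe]
    exact h x y

/-- In a factorial language a word outside the language has empty context, so all such words
collapse to zero; membership thus depends only on the class. -/
theorem syntacticClass_eq_nil_iff (hL : IsFactorial L) {w : List A} :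
    syntacticClass L w = syntacticClass L [] ↔ w ∉ L := by
  cases w with
  | nil => simpa using hL.nil_notMem
  | cons a w =>
  refine (Con.eq (syntacticCon L)).trans ⟨fun h hw => ?_, fun h => ?_⟩
  · have h' := Set.ext_iff.1 (show context L _ = context L _ from h) ([], [])
    rw [mem_context_coe, context_zero] at h'
    exact h'.1 (by simpa [word] using hw)
  · refine Set.ext fun ⟨x, y⟩ => ?_
    rw [mem_context_coe, context_zero]
    exact iff_of_false (fun h' => h (hL.mem_of_append h' (List.cons_ne_nil _ _))) (by simp)

theorem mem_of_syntacticClass_eq (hL : IsFactorial L) {v w : List A}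
    (h : syntacticClass L v = syntacticClass L w) (hv : v ∈ L) : w ∈ L := by
  by_contra hw
  rw [(syntacticClass_eq_nil_iff hL).2 hw] at h
  exact (syntacticClass_eq_nil_iff hL).1 h hv

theorem append_mem_of_syntacticClass_eq {v w x y : List A} (hv : v ≠ [])
    (hw : w ≠ []) (h : syntacticClass L v = syntacticClass L w) (hm : x ++ v ++ y ∈ L) :
    x ++ w ++ y ∈ L :=
  ((syntacticClass_eq_iff hv hw).1 h x y).1 hm

theorem exists_eq_syntacticClass (hL : IsFactorial L) (s : SyntacticSemigroup L) :
    s = syntacticClass L [] ∨ ∃ w ∈ L, s = syntacticClass L w := by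
  induction s using Con.induction_on with
  | H s =>
  induction s using WithZero.recZeroCoe with
  | zero => exact Or.inl rfl
  | coe a =>
  change syntacticClass L (a.head :: a.tail) = _ ∨ ∃ w ∈ L, syntacticClass L (a.head :: a.tail) = _
  by_cases h : a.head :: a.tail ∈ L
  · exact Or.inr ⟨_, h, rfl⟩
  · exact Or.inl ((syntacticClass_eq_nil_iff hL).2 h)

end FactorialLanguages

/-! ### Isomorphic idempotents in a Karoubi envelope. -/

section KaroubiObjects

variable {S : Type u} [Semigroup S]

theorem KaroubiEnvelope.left_mul {e f : KaroubiEnvelope S} (s : f ⟶ e) : e.e * s.1 = s.1 := by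
  rw [← s.2, ← mul_assoc, ← mul_assoc, e.idem]

theorem KaroubiEnvelope.right_mul {e f : KaroubiEnvelope S} (s : f ⟶ e) : s.1 * f.e = s.1 := by
  rw [← s.2, mul_assoc, f.idem]

/-- If `x y` is idempotent then so is `y x y x`, and the two are isomorphic. -/
theorem KaroubiEnvelope.nonempty_iso {e f : KaroubiEnvelope S} {x y : S} (he : e.e = x * y)
    (hf : f.e = y * x * (y * x)) : Nonempty (f ≅ e) := by
  have h : x * y * (x * y) = x * y := he ▸ e.idem
  have h' (s : S) : x * (y * (x * (y * s))) = x * (y * s) := by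
    simpa only [mul_assoc] using congrArg (· * s) h
  have h'' : x * (y * (x * y)) = x * y := by simpa only [mul_assoc] using h
  exact ⟨⟨⟨x * y * x, by simp only [he, hf, mul_assoc, h']⟩,
    ⟨y * x * y, by simp only [he, hf, mul_assoc, h'']⟩,
    Subtype.ext (show y * x * y * (x * y * x) = f.e by simp only [hf, mul_assoc, h']),
    Subtype.ext (show x * y * x * (y * x * y) = e.e by simp only [he, mul_assoc, h''])⟩⟩

end KaroubiObjects

/-! ### Recognizable morphisms and the functor they induce. -/

section RecognizableMorphisms

variable {C A : Type u}

/-- Wherever the image of `a w b` under the morphism `h` occurs in the image of an element of `L`,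
the part that comes from `w` is the image of an occurrence of `w`. -/
def Recognizes (L : Language C) (h : C → List A) (a w b : List C) : Prop :=
  ∀ z ∈ L, ∀ P Q : List A, z.flatMap h = P ++ (a ++ w ++ b).flatMap h ++ Q →
    ∃ a' b', z = a' ++ w ++ b' ∧ a'.flatMap h = P ++ a.flatMap h ∧
      b'.flatMap h = b.flatMap h ++ Q

/-- A morphism between languages that is recognizable up to a margin of `k` letters. -/
structure IsRecognizable (L : Language C) (M : Language A) (h : C → List A) (k : ℕ) : Prop where
  nonerasing : ∀ c, h c ≠ []
  factorial_source : IsFactorial L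
  prolongable_source : IsProlongable L
  factorial_target : IsFactorial M
  map_mem : ∀ w ∈ L, w.flatMap h ∈ M
  exists_factor : ∀ w ∈ M, ∃ z ∈ L, ∃ P Q, z.flatMap h = P ++ w ++ Q
  recognizes : ∀ a w b, a ++ w ++ b ∈ L → k ≤ a.length → k ≤ b.length → Recognizes L h a w b
  -- Needed only for essential surjectivity: an idempotent word need not be cut at boundaries of
  -- images of letters, but a rotation of a representative is.
  exists_conjugate : ∀ y ∈ M, syntacticClass M y * syntacticClass M y = syntacticClass M y →
    ∃ o r t, o ≠ [] ∧ r ≠ [] ∧ syntacticClass M (o ++ r) = syntacticClass M y ∧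
      t.flatMap h = r ++ o ∧ k ≤ t.length ∧ t ++ t ++ t ∈ L

variable {L : Language C} {M : Language A} {h : C → List A} {k : ℕ}

theorem flatMap_ne_nil (hne : ∀ c, h c ≠ []) {w : List C} (hw : w ≠ []) : w.flatMap h ≠ [] := by
  cases w with
  | nil => exact absurd rfl hw
  | cons a w => simp [hne a]

theorem exists_append_of_flatMap_length_le (hne : ∀ c, h c ≠ []) {a b c d : List C}
    (e : a ++ b = c ++ d) (hl : (a.flatMap h).length ≤ (c.flatMap h).length) :
    ∃ x, c = a ++ x ∧ b = x ++ d := by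
  rcases List.append_eq_append_iff.1 e with ⟨x, hx⟩ | ⟨x, rfl, rfl⟩
  · exact ⟨x, hx⟩
  · have hx : x = [] := by
      by_contra hx
      have := List.length_pos_of_ne_nil (flatMap_ne_nil hne hx)
      simp only [List.flatMap_append, List.length_append] at hl
      omega
    subst hx
    exact ⟨[], by simp, by simp⟩

theorem eq_of_append_eq_append (hne : ∀ c, h c ≠ []) {a b c d : List C}
    (e : a ++ b = c ++ d) (hl : a.flatMap h = c.flatMap h) : a = c ∧ b = d := by
  obtain ⟨x, rfl, rfl⟩ := exists_append_of_flatMap_length_le hne e (by rw [hl])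
  have hx : x = [] := by
    by_contra hx
    exact flatMap_ne_nil hne hx (by simpa using hl)
  subst hx
  simp

/-- Both hypotheses locate the cut between `m₁` and `m₂`. The prefixes found up to that cut have
equal images, so they coincide because `h` is nonerasing, and the two occurrences fit together. -/
theorem Recognizes.glue (hne : ∀ c, h c ≠ []) {a w m₁ m₂ x b : List C}
    (h₁ : Recognizes L h a (w ++ m₁) m₂) (h₂ : Recognizes L h m₁ (m₂ ++ x) b) :
    Recognizes L h a (w ++ m₁ ++ m₂ ++ x) b := by
  intro z hz P Q e
  obtain ⟨a₁, b₁, e₁, ha₁, -⟩ := h₁ z hz P ((x ++ b).flatMap h ++ Q) (by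
    simpa only [List.flatMap_append, List.append_assoc] using e)
  obtain ⟨a₂, b₂, e₂, ha₂, hb₂⟩ := h₂ z hz (P ++ (a ++ w).flatMap h) Q (by
    simpa only [List.flatMap_append, List.append_assoc] using e)
  have key := eq_of_append_eq_append hne (a := a₁ ++ (w ++ m₁)) (b := b₁) (c := a₂)
    (d := m₂ ++ x ++ b₂) (by rw [← e₁, e₂, List.append_assoc a₂])
    (by simp only [List.flatMap_append, List.append_assoc, ha₁, ha₂])
  refine ⟨a₁, b₂, ?_, ha₁, hb₂⟩
  rw [e₂, ← key.1]
  simp only [List.append_assoc]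

namespace IsRecognizable

theorem image_ne_nil (R : IsRecognizable L M h k) {w : List C} (hw : w ≠ []) :
    w.flatMap h ≠ [] :=
  flatMap_ne_nil R.nonerasing hw

theorem exists_append_mem (R : IsRecognizable L M h k) {a w b : List C}
    (hr : Recognizes L h a w b) {P Q : List A}
    (hm : P ++ (a ++ w ++ b).flatMap h ++ Q ∈ M) :
    ∃ P' Q' a' b', a' ++ w ++ b' ∈ L ∧ a'.flatMap h = P' ++ P ++ a.flatMap h ∧
      b'.flatMap h = b.flatMap h ++ Q ++ Q' := by
  obtain ⟨z, hz, P', Q', e⟩ := R.exists_factor _ hm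
  obtain ⟨a', b', rfl, ha, hb⟩ := hr z hz (P' ++ P) (Q ++ Q') (by
    simpa only [List.append_assoc] using e)
  exact ⟨P', Q', a', b', hz, ha, by simpa using hb⟩

theorem mem_of_image_mem (R : IsRecognizable L M h k) {a w b : List C} (hw : w ≠ [])
    (hr : Recognizes L h a w b) (hm : (a ++ w ++ b).flatMap h ∈ M) : w ∈ L := by
  obtain ⟨P', Q', a', b', hz, -, -⟩ := R.exists_append_mem hr (P := []) (Q := []) (by simpa using hm)
  exact R.factorial_source.mem_of_append hz hw

/-- The context is pulled back to a context of `w` in `L`, where `w'` may replace `w`; the result is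
then mapped forward again. -/
theorem append_image_mem (R : IsRecognizable L M h k) {a w w' b : List C} (hw : w ≠ [])
    (hw' : w' ≠ []) (hr : Recognizes L h a w b) (e : syntacticClass L w = syntacticClass L w')
    {P Q : List A} (hm : P ++ (a ++ w ++ b).flatMap h ++ Q ∈ M) :
    P ++ (a ++ w' ++ b).flatMap h ++ Q ∈ M := by
  obtain ⟨P', Q', a', b', hz, ha, hb⟩ := R.exists_append_mem hr hm
  have hz' := R.map_mem _ (append_mem_of_syntacticClass_eq hw hw' e hz)
  refine R.factorial_target.mem_of_append (x := P') (y := Q') ?_ ?_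
  · simpa only [List.flatMap_append, List.append_assoc, ha, hb] using hz'
  · simp [R.image_ne_nil hw', List.flatMap_append, -List.flatMap_eq_nil_iff]

theorem syntacticClass_image_eq (R : IsRecognizable L M h k) {a w w' b : List C} (hw : w ≠ [])
    (hw' : w' ≠ []) (e : syntacticClass L w = syntacticClass L w') (hm : a ++ w ++ b ∈ L)
    (ha : k ≤ a.length) (hb : k ≤ b.length) :
    syntacticClass M ((a ++ w ++ b).flatMap h) = syntacticClass M ((a ++ w' ++ b).flatMap h) := by
  have hm' := append_mem_of_syntacticClass_eq hw hw' e hm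
  rw [syntacticClass_eq_iff (R.image_ne_nil (by simp [hw])) (R.image_ne_nil (by simp [hw']))]
  exact fun x y => ⟨R.append_image_mem hw hw' (R.recognizes _ _ _ hm ha hb) e,
    R.append_image_mem hw' hw (R.recognizes _ _ _ hm' ha hb) e.symm⟩

end IsRecognizable

/-- Words with idempotent class, of length at least `k` if they belong to the language. -/
structure LongIdempotent (L : Language C) (k : ℕ) : Type u where
  word : List C
  idem : syntacticClass L word * syntacticClass L word = syntacticClass L word
  long : word ∈ L → k ≤ word.length

/-- The object of the Karoubi envelope given by a word with idempotent class. -/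
def LongIdempotent.toKaroubi (u : LongIdempotent L k) : KaroubiEnvelope (SyntacticSemigroup L) :=
  ⟨syntacticClass L u.word, u.idem⟩

/-- Appending further copies of `w` lengthens the word without changing an idempotent class. -/
theorem exists_long_word {w : List C} (hw : w ≠ [])
    (hi : syntacticClass L w * syntacticClass L w = syntacticClass L w) (n : ℕ) :
    ∃ v, v ≠ [] ∧ n ≤ v.length ∧ syntacticClass L v = syntacticClass L w := by
  induction n with
  | zero => exact ⟨w, hw, Nat.zero_le _, rfl⟩
  | succ n ih =>
    obtain ⟨v, hv, hn, e⟩ := ih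
    refine ⟨v ++ w, by simp [hw], ?_, by rw [syntacticClass_append hv hw, e, hi]⟩
    have := List.length_pos_of_ne_nil hw
    rw [List.length_append]
    omega

theorem LongIdempotent.exists_toKaroubi_eq (hL : IsFactorial L)
    (e : KaroubiEnvelope (SyntacticSemigroup L)) : ∃ u : LongIdempotent L k, u.toKaroubi = e := by
  obtain ⟨e, he⟩ := e
  rcases exists_eq_syntacticClass hL e with rfl | ⟨w, hw, rfl⟩
  · exact ⟨⟨[], syntacticClass_nil_mul _, fun h => absurd h hL.nil_notMem⟩, rfl⟩
  · obtain ⟨v, -, hn, e⟩ := exists_long_word (hL.ne_nil hw) he k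
    exact ⟨⟨v, by rw [e, he], fun _ => hn⟩, by simp only [LongIdempotent.toKaroubi, e]⟩

open Classical in
/-- The class of the image of `u w v`, if the given element is the class of a word `w` of the
language, and zero otherwise. -/
noncomputable def imageClass (M : Language A) (h : C → List A) (u v : List C)
    (s : SyntacticSemigroup L) : SyntacticSemigroup M :=
  if H : ∃ w ∈ L, s = syntacticClass L w then syntacticClass M ((u ++ H.choose ++ v).flatMap h)
  else syntacticClass M []

theorem imageClass_nil (hL : IsFactorial L) (u v : List C) :
    imageClass M h u v (syntacticClass L []) = syntacticClass M [] := by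
  rw [imageClass, dif_neg]
  rintro ⟨w, hw, e⟩
  exact (syntacticClass_eq_nil_iff hL).1 e.symm hw

/-- A word which represents a morphism `v ⟶ u` between idempotents of the language. -/
structure Represents (L : Language C) (u v w : List C) : Prop where
  mem : w ∈ L
  mem_left : u ∈ L
  mem_right : v ∈ L
  left_mul : syntacticClass L u * syntacticClass L w = syntacticClass L w
  mul_right : syntacticClass L w * syntacticClass L v = syntacticClass L w

theorem eq_nil_or_represents (hL : IsFactorial L) {u v : LongIdempotent L k}
    (s : v.toKaroubi ⟶ u.toKaroubi) :
    s.1 = syntacticClass L [] ∨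
      ∃ w, Represents L u.word v.word w ∧ s.1 = syntacticClass L w := by
  have hl : syntacticClass L u.word * s.1 = s.1 := KaroubiEnvelope.left_mul s
  have hr : s.1 * syntacticClass L v.word = s.1 := KaroubiEnvelope.right_mul s
  rcases exists_eq_syntacticClass hL s.1 with e | ⟨w, hw, e⟩
  · exact Or.inl e
  · rw [e] at hl hr
    refine Or.inr ⟨w, ⟨hw, ?_, ?_, hl, hr⟩, e⟩
    · by_contra hu
      rw [(syntacticClass_eq_nil_iff hL).2 hu, syntacticClass_nil_mul] at hl
      exact (syntacticClass_eq_nil_iff hL).1 hl.symm hw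
    · by_contra hv
      rw [(syntacticClass_eq_nil_iff hL).2 hv, mul_syntacticClass_nil] at hr
      exact (syntacticClass_eq_nil_iff hL).1 hr.symm hw

namespace IsRecognizable

/-- This frees `imageClass` from its arbitrary choice: `u` and `v` are long enough to serve as
margins, so equivalent words give equivalent images. -/
theorem imageClass_eq (R : IsRecognizable L M h k) {u v : LongIdempotent L k} {w : List C}
    (hw : Represents L u.word v.word w) :
    u.word ++ w ++ v.word ∈ L ∧ imageClass M h u.word v.word (syntacticClass L w) =
      syntacticClass M ((u.word ++ w ++ v.word).flatMap h) := by
  have hL := R.factorial_source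
  have h1 := hL.ne_nil hw.mem
  have hu := hL.ne_nil hw.mem_left
  have hv := hL.ne_nil hw.mem_right
  have hm {w'} (hw' : w' ∈ L) (e : syntacticClass L w = syntacticClass L w') :
      u.word ++ w' ++ v.word ∈ L := by
    have h1' := hL.ne_nil hw'
    refine mem_of_syntacticClass_eq hL ?_ hw.mem
    rw [syntacticClass_append (by simp [h1']) hv, syntacticClass_append hu h1', ← e, hw.left_mul,
      hw.mul_right]
  refine ⟨hm hw.mem rfl, ?_⟩
  have H : ∃ w' ∈ L, syntacticClass L w = syntacticClass L w' := ⟨w, hw.mem, rfl⟩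
  rw [imageClass, dif_pos H]
  exact R.syntacticClass_image_eq (hL.ne_nil H.choose_spec.1) h1 H.choose_spec.2.symm
    (hm H.choose_spec.1 H.choose_spec.2) (u.long hw.mem_left) (v.long hw.mem_right)

/-- The product of the images is that of `u(wvvx)t`, and `wvvx` has the class of `wx` because `v`
acts as an identity between them. -/
theorem imageClass_mul (R : IsRecognizable L M h k) {u v t : LongIdempotent L k}
    (s : v.toKaroubi ⟶ u.toKaroubi) (s' : t.toKaroubi ⟶ v.toKaroubi) :
    imageClass M h u.word t.word (s.1 * s'.1) =
      imageClass M h u.word v.word s.1 * imageClass M h v.word t.word s'.1 := by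
  have hL := R.factorial_source
  rcases eq_nil_or_represents hL s with e | ⟨w, hw, e⟩
  · rw [e, syntacticClass_nil_mul, imageClass_nil hL, imageClass_nil hL, syntacticClass_nil_mul]
  rcases eq_nil_or_represents hL s' with e' | ⟨x, hx, e'⟩
  · rw [e', mul_syntacticClass_nil, imageClass_nil hL, imageClass_nil hL, mul_syntacticClass_nil]
  have hw0 := hL.ne_nil hw.mem
  have hx0 := hL.ne_nil hx.mem
  have hu0 := hL.ne_nil hw.mem_left
  have hv0 := hL.ne_nil hw.mem_right
  have ht0 := hL.ne_nil hx.mem_right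
  have huw (s) : syntacticClass L u.word * (syntacticClass L w * s) = syntacticClass L w * s := by
    rw [← mul_assoc, hw.left_mul]
  have hwv (s) : syntacticClass L w * (syntacticClass L v.word * s) = syntacticClass L w * s := by
    rw [← mul_assoc, hw.mul_right]
  obtain ⟨m₁, e₁⟩ := R.imageClass_eq hw
  obtain ⟨m₂, e₂⟩ := R.imageClass_eq hx
  rw [e, e', e₁, e₂, ← syntacticClass_append (R.image_ne_nil (by simp [hw0]))
    (R.image_ne_nil (by simp [hx0])), ← syntacticClass_append hw0 hx0]
  have ha : (u.word ++ w ++ v.word).flatMap h ++ (v.word ++ x ++ t.word).flatMap h =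
      (u.word ++ (w ++ v.word ++ v.word ++ x) ++ t.word).flatMap h := by
    simp only [List.flatMap_append, List.append_assoc]
  have hc : syntacticClass L (w ++ x) = syntacticClass L (w ++ v.word ++ v.word ++ x) := by
    simp [syntacticClass_append, hw0, hx0, hv0, hwv]
  rw [ha]
  by_cases hm : w ++ x ∈ L
  · have hr : Represents L u.word t.word (w ++ x) := ⟨hm, hw.mem_left, hx.mem_right, by
      rw [syntacticClass_append hw0 hx0, huw], by
      rw [syntacticClass_append hw0 hx0, mul_assoc, hx.mul_right]⟩
    obtain ⟨m₃, e₃⟩ := R.imageClass_eq hr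
    rw [e₃]
    exact R.syntacticClass_image_eq (by simp [hw0]) (by simp [hw0]) hc m₃
      (u.long hw.mem_left) (t.long hx.mem_right)
  -- A zero product must stay zero. No element of `L` is available to start from here, so the
  -- recognitions of the two factors are glued along the overlap `vv`.
  · rw [(syntacticClass_eq_nil_iff hL).2 hm, imageClass_nil hL, eq_comm,
      syntacticClass_eq_nil_iff R.factorial_target]
    refine fun hM => hm (mem_of_syntacticClass_eq hL hc.symm
      (R.mem_of_image_mem (by simp [hw0]) ?_ hM))
    have h₁ : u.word ++ (w ++ v.word) ++ v.word ∈ L := by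
      refine mem_of_syntacticClass_eq hL ?_ hw.mem
      simp [syntacticClass_append, hw0, hu0, hv0, hwv, hw.left_mul, hw.mul_right]
    have h₂ : v.word ++ (v.word ++ x) ++ t.word ∈ L := by
      refine mem_of_syntacticClass_eq hL ?_ hx.mem
      simp [syntacticClass_append, hx0, ht0, hv0, hx.mul_right, hx.left_mul]
    have lv := v.long hw.mem_right
    exact (R.recognizes _ _ _ h₁ (u.long hw.mem_left) lv).glue R.nonerasing
      (R.recognizes _ _ _ h₂ lv (t.long hx.mem_right))

/-- The object of the Karoubi envelope of the target that corresponds to a long idempotent word. -/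
noncomputable def obj (R : IsRecognizable L M h k) (u : LongIdempotent L k) :
    KaroubiEnvelope (SyntacticSemigroup M) :=
  ⟨imageClass M h u.word u.word (syntacticClass L u.word), by
    have := R.imageClass_mul (𝟙 u.toKaroubi) (𝟙 u.toKaroubi)
    have e : (𝟙 u.toKaroubi : u.toKaroubi ⟶ u.toKaroubi).1 = syntacticClass L u.word := rfl
    rw [e, u.idem] at this
    exact this.symm⟩

/-- The functor between Karoubi envelopes given by a recognizable morphism. -/
noncomputable def functor (R : IsRecognizable L M h k) :
    InducedCategory (KaroubiEnvelope (SyntacticSemigroup L))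
      (LongIdempotent.toKaroubi : LongIdempotent L k → _) ⥤
    KaroubiEnvelope (SyntacticSemigroup M) where
  obj u := R.obj u
  map {v u} s := ⟨imageClass M h (LongIdempotent.word u) (LongIdempotent.word v) s.hom.1, by
    have h1 := R.imageClass_mul (𝟙 (LongIdempotent.toKaroubi u)) s.hom
    have h2 := R.imageClass_mul s.hom (𝟙 (LongIdempotent.toKaroubi v))
    have h3 := KaroubiEnvelope.left_mul s.hom
    have h4 := KaroubiEnvelope.right_mul s.hom
    refine (congrArg (· * _) (h1.symm.trans ?_)).trans (h2.symm.trans ?_)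
    · exact congrArg _ h3
    · exact congrArg _ h4⟩
  map_id u := rfl
  map_comp s s' := Subtype.ext (R.imageClass_mul s'.hom s.hom)

end IsRecognizable

end RecognizableMorphisms

/-! ### The induced functor is faithful, full and essentially surjective. -/

section Equivalence

variable {C A : Type u} {L : Language C} {M : Language A} {h : C → List A} {k : ℕ}

namespace IsRecognizable

/-- Faithfulness. In a context `(p, q)`, `w` may be replaced by `uuwvv`; the inner `uwv` is
exchanged for `uw'v` after applying `h`, and the result is desubstituted. -/
theorem append_mem_of_imageClass_eq (R : IsRecognizable L M h k) {u v : LongIdempotent L k}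
    {w w' : List C} (hw : Represents L u.word v.word w) (hw' : Represents L u.word v.word w')
    (e : imageClass M h u.word v.word (syntacticClass L w) =
      imageClass M h u.word v.word (syntacticClass L w')) {p q : List C}
    (hm : p ++ w ++ q ∈ L) : p ++ w' ++ q ∈ L := by
  have hL := R.factorial_source
  have hw0 := hL.ne_nil hw.mem
  have hw0' := hL.ne_nil hw'.mem
  have hu0 := hL.ne_nil hw.mem_left
  have hv0 := hL.ne_nil hw.mem_right
  have lu := u.long hw.mem_left
  have lv := v.long hw.mem_right
  have hc {x : List C} (hx : Represents L u.word v.word x) : syntacticClass L x =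
      syntacticClass L (u.word ++ u.word ++ x ++ v.word ++ v.word) := by
    have h1 (s) : syntacticClass L x * (syntacticClass L v.word * s) = syntacticClass L x * s := by
      rw [← mul_assoc, hx.mul_right]
    simp [syntacticClass_append, hL.ne_nil hx.mem, hu0, hv0, h1, hx.left_mul, hx.mul_right]
  rw [(R.imageClass_eq hw).2, (R.imageClass_eq hw').2] at e
  have hm₁ := append_mem_of_syntacticClass_eq hw0 (by simp [hw0]) (hc hw) hm
  -- `p` and `q` may be short or empty; `p₀` and `q₀` provide the outer margins. Three overlapping
  -- recognitions, glued along `uu` and `vv`, then cover the whole word.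
  obtain ⟨p₀, q₀, hp, hq, hm₂⟩ := R.prolongable_source _ hm₁ k
  have hm₃ : (p₀ ++ (p ++ u.word ++ u.word ++ w' ++ v.word ++ v.word ++ q) ++ q₀).flatMap h ∈ M := by
    have := R.map_mem _ hm₂
    have := append_mem_of_syntacticClass_eq (x := (p₀ ++ p ++ u.word).flatMap h)
      (y := (v.word ++ q ++ q₀).flatMap h) (R.image_ne_nil (by simp [hw0]))
      (R.image_ne_nil (by simp [hw0'])) e
      (by simpa only [List.flatMap_append, List.append_assoc] using this)
    simpa only [List.flatMap_append, List.append_assoc] using this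
  have r₁ : Recognizes L h p₀ (p ++ u.word) u.word := by
    refine R.recognizes _ _ _ (hL.mem_of_append (x := []) (y := w ++ v.word ++ v.word ++ q ++ q₀)
      ?_ (by simp [hu0])) hp lu
    simpa using hm₂
  have r₃ : Recognizes L h v.word (v.word ++ q) q₀ := by
    refine R.recognizes _ _ _ (hL.mem_of_append (x := p₀ ++ p ++ u.word ++ u.word ++ w) (y := [])
      ?_ (by simp [hv0])) lv hq
    simpa using hm₂
  have r₂ : Recognizes L h u.word (u.word ++ (w' ++ v.word)) v.word := by
    refine R.recognizes _ _ _ (mem_of_syntacticClass_eq hL ?_ hw'.mem) lu lv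
    rw [hc hw']
    simp only [List.append_assoc]
  have r₄ : Recognizes L h p₀ (p ++ u.word ++ u.word ++ w' ++ v.word) v.word := by
    simpa only [List.append_assoc] using r₁.glue R.nonerasing r₂
  have hm₄ := R.mem_of_image_mem (by simp [hw0']) (r₄.glue R.nonerasing r₃) hm₃
  exact append_mem_of_syntacticClass_eq (by simp [hw0']) hw0' (hc hw').symm
    (by simpa only [List.append_assoc] using hm₄)

theorem eq_of_imageClass_eq (R : IsRecognizable L M h k) {u v : LongIdempotent L k}
    (s s' : v.toKaroubi ⟶ u.toKaroubi)
    (e : imageClass M h u.word v.word s.1 = imageClass M h u.word v.word s'.1) : s = s' := by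
  have hL := R.factorial_source
  refine Subtype.ext ?_
  have h0 {w} (hw : Represents L u.word v.word w) :
      imageClass M h u.word v.word (syntacticClass L w) ≠ syntacticClass M [] := by
    obtain ⟨m, e⟩ := R.imageClass_eq hw
    rw [e, Ne, syntacticClass_eq_nil_iff R.factorial_target, not_not]
    exact R.map_mem _ m
  rcases eq_nil_or_represents hL s with hs | ⟨w, hw, hs⟩ <;>
    rcases eq_nil_or_represents hL s' with hs' | ⟨w', hw', hs'⟩ <;> rw [hs, hs'] at e ⊢
  · rw [imageClass_nil hL] at e
    exact absurd e.symm (h0 hw')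
  · rw [imageClass_nil hL] at e
    exact absurd e (h0 hw)
  · rw [syntacticClass_eq_iff (hL.ne_nil hw.mem) (hL.ne_nil hw'.mem)]
    exact fun p q => ⟨R.append_mem_of_imageClass_eq hw hw' e,
      R.append_mem_of_imageClass_eq hw' hw e.symm⟩

theorem obj_e_eq_nil_or (R : IsRecognizable L M h k) (u : LongIdempotent L k) :
    (R.obj u).e = syntacticClass M [] ∨ u.word ∈ L ∧ u.word ++ u.word ++ u.word ∈ L ∧
      (R.obj u).e = syntacticClass M ((u.word ++ u.word ++ u.word).flatMap h) := by
  by_cases hu : u.word ∈ L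
  · exact Or.inr ⟨hu, R.imageClass_eq ⟨hu, hu, hu, u.idem, u.idem⟩⟩
  · left
    change imageClass M h u.word u.word (syntacticClass L u.word) = _
    rw [(syntacticClass_eq_nil_iff R.factorial_source).2 hu, imageClass_nil R.factorial_source]

/-- Fullness. The word `h(uuu) y h(vvv)` has the class of `y`; in an image containing it, the middle
`u` and the middle `v` are recognized, and the word between them yields the preimage. -/
theorem exists_imageClass_eq (R : IsRecognizable L M h k) {u v : LongIdempotent L k}
    (r : R.obj v ⟶ R.obj u) :
    ∃ s : v.toKaroubi ⟶ u.toKaroubi, imageClass M h u.word v.word s.1 = r.1 := by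
  have hL := R.factorial_source
  have hM := R.factorial_target
  have hl := KaroubiEnvelope.left_mul r
  have hr := KaroubiEnvelope.right_mul r
  rcases exists_eq_syntacticClass hM r.1 with e | ⟨y, hy, e⟩
  · exact ⟨⟨syntacticClass L [], by rw [mul_syntacticClass_nil, syntacticClass_nil_mul]⟩, by
      rw [e]; exact imageClass_nil hL _ _⟩
  have hy0 := hM.ne_nil hy
  rw [e] at hl hr ⊢
  rcases R.obj_e_eq_nil_or u with hu | ⟨hu, huuu, eu⟩
  · rw [hu, syntacticClass_nil_mul] at hl
    exact absurd hy ((syntacticClass_eq_nil_iff hM).1 hl.symm)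
  rcases R.obj_e_eq_nil_or v with hv | ⟨hv, hvvv, ev⟩
  · rw [hv, mul_syntacticClass_nil] at hr
    exact absurd hy ((syntacticClass_eq_nil_iff hM).1 hr.symm)
  have hu0 := hL.ne_nil hu
  have hv0 := hL.ne_nil hv
  rw [eu] at hl
  rw [ev] at hr
  have hm : (u.word ++ u.word ++ u.word).flatMap h ++ y ++ (v.word ++ v.word ++ v.word).flatMap h ∈
      M := by
    refine mem_of_syntacticClass_eq hM ?_ hy
    rw [syntacticClass_append (by simp [hy0]) (R.image_ne_nil (by simp [hv0])),
      syntacticClass_append (R.image_ne_nil (by simp [hu0])) hy0, hl, hr]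
  obtain ⟨z, hz, P, Q, ez⟩ := R.exists_factor _ hm
  obtain ⟨a, b, e₁, ha, -⟩ := R.recognizes _ _ _ huuu (u.long hu) (u.long hu) z hz P
    (y ++ (v.word ++ v.word ++ v.word).flatMap h ++ Q) (by
      rw [ez]; simp only [List.append_assoc])
  obtain ⟨a', b', e₂, ha', -⟩ := R.recognizes _ _ _ hvvv (v.long hv) (v.long hv) z hz
    (P ++ (u.word ++ u.word ++ u.word).flatMap h ++ y) Q (by
      rw [ez]; simp only [List.append_assoc])
  have e₃ : a ++ u.word ++ b = a' ++ (v.word ++ b') := by rw [← e₁, e₂, List.append_assoc]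
  obtain ⟨c, rfl, -⟩ := exists_append_of_flatMap_length_le R.nonerasing e₃ (by
    rw [List.flatMap_append, ha', ha]
    simp only [List.flatMap_append, List.append_assoc, List.length_append]
    omega)
  -- `c` lies between the two middle copies, so its image includes the last copy of `h(u)` and the
  -- first copy of `h(v)`.
  have hc : c.flatMap h = u.word.flatMap h ++ y ++ v.word.flatMap h := by
    simpa only [List.flatMap_append, List.append_assoc, ha, List.append_cancel_left_eq] using ha'
  have hc0 : c ≠ [] := by
    rintro rfl
    simp [hy0] at hc
  have hucv : u.word ++ c ++ v.word ∈ L := by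
    refine hL.mem_of_append (x := a) (y := b') ?_ (by simp [hc0])
    simpa only [e₂, List.append_assoc] using hz
  have hui (s) : syntacticClass L u.word * (syntacticClass L u.word * s) =
      syntacticClass L u.word * s := by rw [← mul_assoc, u.idem]
  have hx : Represents L u.word v.word (u.word ++ c ++ v.word) := ⟨hucv, hu, hv, by
    simp [syntacticClass_append, hu0, hv0, hc0, hui], by
    simp [syntacticClass_append, hu0, hv0, hc0, mul_assoc, v.idem]⟩
  refine ⟨⟨syntacticClass L (u.word ++ c ++ v.word), ?_⟩, ?_⟩
  · exact (congrArg (· * _) hx.left_mul).trans hx.mul_right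
  · refine (R.imageClass_eq hx).2.trans ?_
    have : (u.word ++ (u.word ++ c ++ v.word) ++ v.word).flatMap h =
        (u.word ++ u.word ++ u.word).flatMap h ++ y ++ (v.word ++ v.word ++ v.word).flatMap h := by
      simp only [List.flatMap_append, hc, List.append_assoc]
    rw [this, syntacticClass_append (by simp [hy0]) (R.image_ne_nil (by simp [hv0])),
      syntacticClass_append (R.image_ne_nil (by simp [hu0])) hy0, hl, hr]

/-- If the images of `t²` and `t³` have the same class, and `t` is long enough, then `t²` and `t³`
have the same class. -/
theorem syntacticClass_sq_eq_cube (R : IsRecognizable L M h k) {t : List C} (hk : k ≤ t.length)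
    (ht : t ++ t ++ t ∈ L)
    (e : syntacticClass M ((t ++ t).flatMap h) = syntacticClass M ((t ++ t ++ t).flatMap h)) :
    syntacticClass L (t ++ t) = syntacticClass L (t ++ t ++ t) := by
  have hL := R.factorial_source
  have ht0 : t ≠ [] := by
    rintro rfl
    exact hL.nil_notMem ht
  have hc0 : (t ++ t).flatMap h ≠ [] := R.image_ne_nil (by simp [ht0])
  have hc0' : (t ++ t ++ t).flatMap h ≠ [] := R.image_ne_nil (by simp [ht0])
  rw [syntacticClass_eq_iff (by simp [ht0]) (by simp [ht0])]
  refine fun p q => ⟨fun hm => ?_, fun hm => ?_⟩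
  · obtain ⟨p₀, q₀, hp, hq, hm₂⟩ := R.prolongable_source _ hm k
    have r₁ : Recognizes L h p₀ (p ++ t) t := by
      refine R.recognizes _ _ _ (hL.mem_of_append (x := []) (y := q ++ q₀)
        ?_ (by simp [ht0])) hp hk
      simpa using hm₂
    have r₂ : Recognizes L h t (t ++ q) q₀ := by
      refine R.recognizes _ _ _ (hL.mem_of_append (x := p₀ ++ p) (y := []) ?_ (by simp [ht0])) hk hq
      simpa using hm₂
    -- The word to be desubstituted contains `ttt`, one copy more than the given one, so a third
    -- recognition, that of `ttt` itself, is inserted; the converse needs only two.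
    have r₃ : Recognizes L h p₀ (p ++ t ++ t) t := by
      simpa using r₁.glue R.nonerasing (x := []) (by simpa using R.recognizes _ _ _ ht hk hk)
    have hm₃ := append_mem_of_syntacticClass_eq (x := (p₀ ++ p).flatMap h)
      (y := (q ++ q₀).flatMap h) hc0 hc0' e
      (by simpa only [List.flatMap_append, List.append_assoc] using R.map_mem _ hm₂)
    have hm₄ := R.mem_of_image_mem (by simp [ht0]) (r₃.glue R.nonerasing r₂)
      (by simpa only [List.flatMap_append, List.append_assoc] using hm₃)
    simpa only [List.append_assoc] using hm₄
  · obtain ⟨p₀, q₀, hp, hq, hm₂⟩ := R.prolongable_source _ hm k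
    have r₁ : Recognizes L h p₀ (p ++ t) t := by
      refine R.recognizes _ _ _ (hL.mem_of_append (x := []) (y := t ++ q ++ q₀)
        ?_ (by simp [ht0])) hp hk
      simpa using hm₂
    have r₂ : Recognizes L h t (t ++ q) q₀ := by
      refine R.recognizes _ _ _ (hL.mem_of_append (x := p₀ ++ p ++ t) (y := [])
        ?_ (by simp [ht0])) hk hq
      simpa using hm₂
    have hm₃ := append_mem_of_syntacticClass_eq (x := (p₀ ++ p).flatMap h)
      (y := (q ++ q₀).flatMap h) hc0' hc0 e.symm
      (by simpa only [List.flatMap_append, List.append_assoc] using R.map_mem _ hm₂)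
    have hm₄ := R.mem_of_image_mem (by simp [ht0]) (r₁.glue R.nonerasing r₂)
      (by simpa only [List.flatMap_append, List.append_assoc] using hm₃)
    simpa only [List.append_assoc] using hm₄

theorem exists_obj_iso (R : IsRecognizable L M h k) (e : KaroubiEnvelope (SyntacticSemigroup M)) :
    ∃ u : LongIdempotent L k, Nonempty (R.obj u ≅ e) := by
  have hL := R.factorial_source
  obtain ⟨e, he⟩ := e
  rcases exists_eq_syntacticClass R.factorial_target e with rfl | ⟨y, hy, rfl⟩
  · refine ⟨⟨[], syntacticClass_nil_mul _, fun h => absurd h hL.nil_notMem⟩,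
      KaroubiEnvelope.nonempty_iso (x := syntacticClass M []) (y := syntacticClass M []) ?_ ?_⟩
    · simp only [syntacticClass_nil_mul]
    · simp only [syntacticClass_nil_mul]
      exact imageClass_nil hL _ _
  obtain ⟨o, r, t, ho, hr, hy', ht, hk, hm⟩ := R.exists_conjugate y hy he
  have ht0 : t ≠ [] := by
    rintro rfl
    exact hL.nil_notMem hm
  have hi : syntacticClass M (o ++ r) * syntacticClass M (o ++ r) = syntacticClass M (o ++ r) := by
    rw [hy', he]
  rw [syntacticClass_append ho hr] at hi
  have h1 (s) : syntacticClass M o * (syntacticClass M r * (syntacticClass M o *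
      (syntacticClass M r * s))) = syntacticClass M o * (syntacticClass M r * s) := by
    simpa only [mul_assoc] using congrArg (· * s) hi
  have e2 : syntacticClass M ((t ++ t).flatMap h) = syntacticClass M r * syntacticClass M o *
      (syntacticClass M r * syntacticClass M o) := by
    simp [ht, syntacticClass_append, ho, hr, mul_assoc]
  have e3 : syntacticClass M ((t ++ t ++ t).flatMap h) = syntacticClass M r * syntacticClass M o *
      (syntacticClass M r * syntacticClass M o) := by
    simp [ht, syntacticClass_append, ho, hr, mul_assoc, h1]
  have hc := R.syntacticClass_sq_eq_cube hk hm (e2.trans e3.symm)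
  have hmm : t ++ t ∈ L := mem_of_syntacticClass_eq hL hc.symm hm
  -- Replacing `tt` by `ttt` twice turns `tt` into its own square.
  have hui : syntacticClass L (t ++ t) * syntacticClass L (t ++ t) = syntacticClass L (t ++ t) := by
    conv_rhs => rw [hc, syntacticClass_append (by simp [ht0]) ht0, hc]
    simp [syntacticClass_append, ht0, mul_assoc]
  refine ⟨⟨t ++ t, hui, fun _ => by rw [List.length_append]; omega⟩,
    KaroubiEnvelope.nonempty_iso (x := syntacticClass M o) (y := syntacticClass M r) ?_ ?_⟩
  · change syntacticClass M y = _
    rw [← hy', syntacticClass_append ho hr]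
  · refine (R.imageClass_eq ⟨hmm, hmm, hmm, hui, hui⟩).2.trans ?_
    simp [ht, syntacticClass_append, ho, hr, mul_assoc, h1]

/-- The Karoubi envelopes of the syntactic semigroups of two languages are equivalent if there is a
recognizable morphism between the languages. -/
theorem nonempty_equivalence (R : IsRecognizable L M h k) :
    Nonempty (KaroubiEnvelope (SyntacticSemigroup L) ≌ KaroubiEnvelope (SyntacticSemigroup M)) := by
  -- The functor depends on the words chosen for the objects, so its source has long words as
  -- objects; `I` identifies this category with the Karoubi envelope.
  let I := inducedFunctor (LongIdempotent.toKaroubi : LongIdempotent L k → _)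
  have : I.EssSurj := ⟨fun e => by
    obtain ⟨u, hu⟩ := LongIdempotent.exists_toKaroubi_eq (k := k) R.factorial_source e
    exact ⟨u, ⟨eqToIso hu⟩⟩⟩
  have : I.IsEquivalence := { faithful := InducedCategory.faithful _, full := InducedCategory.full _ }
  have : R.functor.Faithful := ⟨fun {v u s s'} e =>
    InducedCategory.hom_ext (R.eq_of_imageClass_eq s.hom s'.hom (congrArg Subtype.val e))⟩
  have : R.functor.Full := ⟨fun {v u} r => by
    obtain ⟨s, hs⟩ := R.exists_imageClass_eq (u := u) (v := v) r
    exact ⟨InducedCategory.homMk s, Subtype.ext hs⟩⟩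
  have : R.functor.EssSurj := ⟨fun e => R.exists_obj_iso e⟩
  have : R.functor.IsEquivalence := { }
  exact ⟨I.asEquivalence.symm.trans R.functor.asEquivalence⟩

end IsRecognizable

end Equivalence

/-! ### Blocks of bi-infinite sequences. -/

section Blocks

variable {A C : Type u}

/-- The block of length `n` of a sequence that starts at the index `i`. -/
def block (x : ℤ → A) (i : ℤ) (n : ℕ) : List A := (List.range n).map fun k : ℕ => x (i + k)

@[simp]
theorem length_block (x : ℤ → A) (i : ℤ) (n : ℕ) : (block x i n).length = n := by simp [block]

theorem block_add (x : ℤ → A) (i : ℤ) (m n : ℕ) :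
    block x i (m + n) = block x i m ++ block x (i + m) n := by
  simp only [block, List.range_add, List.map_append, List.map_map, Function.comp_def, Nat.cast_add,
    add_assoc]

theorem block_eq_block_iff {x y : ℤ → A} {i j : ℤ} {n : ℕ} :
    block x i n = block y j n ↔ ∀ m : ℕ, m < n → x (i + m) = y (j + m) := by
  simp [block]

theorem map_block (f : C → A) (x : ℤ → C) (i : ℤ) (n : ℕ) :
    (block x i n).map f = block (f ∘ x) i n := by
  simp [block]

theorem eq_block_of_append_eq {x : ℤ → A} {i : ℤ} {n : ℕ} {a b : List A}
    (h : a ++ b = block x i n) : a = block x i a.length ∧ b = block x (i + a.length) b.length := by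
  have hn : n = a.length + b.length := by rw [← List.length_append, h, length_block]
  rw [hn, block_add] at h
  exact List.append_inj h (by simp)

theorem mem_blocks {X : Set (ℤ → A)} {l : List A} :
    l ∈ blocks X ↔ l ≠ [] ∧ ∃ x ∈ X, ∃ i, l = block x i l.length := by
  constructor
  · rintro ⟨x, hx, i, n, rfl⟩
    exact ⟨by simp, x, hx, i, by simp [block]⟩
  · rintro ⟨h0, x, hx, i, h⟩
    refine ⟨x, hx, i, l.length - 1, ?_⟩
    rwa [Nat.sub_add_cancel (List.length_pos_of_ne_nil h0)]

theorem block_mem_blocks {X : Set (ℤ → A)} {x : ℤ → A} (hx : x ∈ X) (i : ℤ) {n : ℕ} (hn : n ≠ 0) :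
    block x i n ∈ blocks X :=
  mem_blocks.2 ⟨by rw [← List.length_pos_iff, length_block]; omega, x, hx, i, by simp⟩

theorem isFactorial_blocks (X : Set (ℤ → A)) : IsFactorial (blocks X) where
  nil_notMem h := (mem_blocks.1 h).1 rfl
  mem_of_append {p w q} h h0 := by
    obtain ⟨-, x, hx, i, e⟩ := mem_blocks.1 h
    have e' := (eq_block_of_append_eq (eq_block_of_append_eq e).1).2
    exact mem_blocks.2 ⟨h0, x, hx, _, e'⟩

theorem isProlongable_blocks (X : Set (ℤ → A)) : IsProlongable (blocks X) := by
  intro w hw n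
  obtain ⟨h0, x, hx, i, e⟩ := mem_blocks.1 hw
  refine ⟨block x (i - n) n, block x (i + w.length) n, by simp, by simp, ?_⟩
  have h : block x (i - n) n ++ w ++ block x (i + w.length) n =
      block x (i - n) (n + w.length + n) := by
    rw [block_add, block_add, e, length_block, sub_add_cancel]
    congr 2
    push_cast
    ring
  rw [h]
  refine block_mem_blocks hx _ ?_
  have := List.length_pos_of_ne_nil h0
  omega

end Blocks

/-! ### Letter-to-letter maps that are injective on a compact invariant set. -/

section LetterMaps

variable {A C : Type u}

/-- If every window failed, translation would give pairs in `Z` that differ at `0` but have equal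
images on `[-n, n]`. These pairs form nested nonempty compact sets, and a common point contradicts
injectivity. -/
theorem exists_window [TopologicalSpace C] [DiscreteTopology C] {Z : Set (ℤ → C)}
    (hZ : IsCompact Z) (hs : ∀ z ∈ Z, ∀ n : ℤ, (fun i => z (i + n)) ∈ Z) {f : C → A}
    (hf : Set.InjOn (fun z : ℤ → C => f ∘ z) Z) :
    ∃ k : ℕ, ∀ z ∈ Z, ∀ z' ∈ Z, ∀ i j : ℤ,
      (∀ d : ℤ, |d| ≤ k → f (z (i + d)) = f (z' (j + d))) → z i = z' j := by
  by_contra! H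
  let D : ℕ → Set ((ℤ → C) × (ℤ → C)) := fun n =>
    Z ×ˢ Z ∩ ({p | p.1 0 ≠ p.2 0} ∩ ⋂ d : ℤ, ⋂ (_ : |d| ≤ n), {p | f (p.1 d) = f (p.2 d)})
  have hcl (d : ℤ) (s : Set (C × C)) :
      IsClosed ((fun p : (ℤ → C) × (ℤ → C) => (p.1 d, p.2 d)) ⁻¹' s) :=
    (isClosed_discrete s).preimage (by fun_prop)
  have hD (n : ℕ) : IsClosed (({p : (ℤ → C) × (ℤ → C) | p.1 0 ≠ p.2 0} ∩
      ⋂ d : ℤ, ⋂ (_ : |d| ≤ n), {p | f (p.1 d) = f (p.2 d)})) :=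
    (hcl 0 {q | q.1 ≠ q.2}).inter
      (isClosed_iInter fun d => isClosed_iInter fun _ => hcl d {q | f q.1 = f q.2})
  have hc (n : ℕ) : IsCompact (D n) := (hZ.prod hZ).inter_right (hD n)
  obtain ⟨p, hp⟩ := IsCompact.nonempty_iInter_of_sequence_nonempty_isCompact_isClosed D
    (fun n p hp => ⟨hp.1, hp.2.1, by
      simp only [Set.mem_iInter]
      exact fun d hd => Set.mem_iInter₂.1 hp.2.2 d (by push_cast; omega)⟩)
    (fun n => by
      obtain ⟨z, hz, z', hz', i, j, h, hne⟩ := H n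
      refine ⟨(fun m => z (m + i), fun m => z' (m + j)), ⟨hs z hz i, hs z' hz' j⟩,
        by simpa using hne, ?_⟩
      simp only [Set.mem_iInter]
      intro d hd
      simpa only [add_comm d, Set.mem_ofPred_eq] using h d hd)
    (hc 0) (fun n => (hZ.prod hZ).isClosed.inter (hD n))
  rw [Set.mem_iInter] at hp
  refine (hp 0).2.1 (congrFun (hf (hp 0).1.1 (hp 0).1.2 (funext fun d => ?_)) 0)
  exact Set.mem_iInter₂.1 (hp d.natAbs).2.2 d (by simp)

theorem flatMap_singleton_eq_map (f : C → A) (l : List C) :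
    (l.flatMap fun c => [f c]) = l.map f := by
  induction l with
  | nil => rfl
  | cons a l ih => simp [ih]

/-- Each letter of `w` is determined by the images within distance `k`, all of which lie inside the
image of `awb`. -/
theorem recognizes_letterMap {Z : Set (ℤ → C)} {f : C → A} {k : ℕ}
    (hk : ∀ z ∈ Z, ∀ z' ∈ Z, ∀ i j : ℤ,
      (∀ d : ℤ, |d| ≤ k → f (z (i + d)) = f (z' (j + d))) → z i = z' j)
    {a w b : List C} (hm : a ++ w ++ b ∈ blocks Z) (ha : k ≤ a.length) (hb : k ≤ b.length) :
    Recognizes (blocks Z) (fun c => [f c]) a w b := by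
  intro l hl P Q e
  simp only [flatMap_singleton_eq_map] at e ⊢
  obtain ⟨-, z, hz, i, ez⟩ := mem_blocks.1 hm
  obtain ⟨-, z', hz', j, el⟩ := mem_blocks.1 hl
  have hlen : l.length = P.length + a.length + w.length + (b.length + Q.length) := by
    simpa [add_assoc] using congrArg List.length e
  have hw : w = block z (i + a.length) w.length :=
    (eq_block_of_append_eq (eq_block_of_append_eq ez).1).2
  have hin : ∀ m : ℕ, m < (a ++ w ++ b).length →
      f (z (i + m)) = f (z' (j + P.length + m)) := by
    rw [el, map_block] at e
    have h1 := (eq_block_of_append_eq (eq_block_of_append_eq e.symm).1).2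
    rw [ez, map_block] at h1
    simp only [length_block] at h1
    exact block_eq_block_iff.1 h1
  have hww : block z' (j + (P.length + a.length : ℕ)) w.length = w := by
    rw [hw, length_block, block_eq_block_iff]
    intro m hm
    refine (hk z hz z' hz' _ _ fun d hd => ?_).symm
    rw [abs_le] at hd
    have := hin (a.length + m + d).toNat (by
      simp only [List.length_append]
      omega)
    rw [Int.toNat_of_nonneg (by omega)] at this
    convert this using 3 <;> push_cast <;> ring
  have e' : l = block z' j (P.length + a.length) ++ w ++
      block z' (j + (P.length + a.length + w.length : ℕ)) (b.length + Q.length) := by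
    rw [el, hlen, block_add, block_add, hww]
  refine ⟨_, _, e', ?_⟩
  rw [e'] at e
  have h1 : List.map f (block z' j (P.length + a.length)) ++ (w.map f ++
      List.map f (block z' (j + (P.length + a.length + w.length : ℕ)) (b.length + Q.length))) =
      (P ++ a.map f) ++ (w.map f ++ (b.map f ++ Q)) := by
    simpa only [List.map_append, List.append_assoc] using e
  obtain ⟨h2, h3⟩ := List.append_inj h1 (by simp)
  exact ⟨h2, (List.append_cancel_left_eq _ _ _).mp h3⟩

theorem isRecognizable_letterMap {Z : Set (ℤ → C)} {f : C → A} {k : ℕ}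
    (hk : ∀ z ∈ Z, ∀ z' ∈ Z, ∀ i j : ℤ,
      (∀ d : ℤ, |d| ≤ k → f (z (i + d)) = f (z' (j + d))) → z i = z' j)
    {X : Set (ℤ → A)} (hX : X = (fun z : ℤ → C => f ∘ z) '' Z) :
    IsRecognizable (blocks Z) (blocks X) (fun c => [f c]) k := by
  have hmap : ∀ w ∈ blocks X, ∃ z ∈ blocks Z, z.map f = w := by
    intro w hw
    obtain ⟨h0, x, hx, i, e⟩ := mem_blocks.1 hw
    rw [hX] at hx
    obtain ⟨z, hz, rfl⟩ := hx
    refine ⟨block z i w.length, block_mem_blocks hz i ?_, by rw [map_block, ← e]⟩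
    exact (List.length_pos_of_ne_nil h0).ne'
  refine ⟨by simp, isFactorial_blocks Z, isProlongable_blocks Z, isFactorial_blocks X, ?_, ?_,
    fun a w b => recognizes_letterMap hk, ?_⟩
  · intro w hw
    obtain ⟨h0, z, hz, i, e⟩ := mem_blocks.1 hw
    rw [flatMap_singleton_eq_map, e, map_block]
    refine block_mem_blocks ?_ i (List.length_pos_of_ne_nil h0).ne'
    rw [hX]
    exact ⟨z, hz, rfl⟩
  · intro w hw
    obtain ⟨z, hz, e⟩ := hmap w hw
    exact ⟨z, hz, [], [], by simp [flatMap_singleton_eq_map, e]⟩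
  · intro y hy hi
    have hM := isFactorial_blocks X
    obtain ⟨v, hv0, hv, e⟩ := exists_long_word (hM.ne_nil hy) hi k
    -- Six copies of `vv` lift to `t₀, …, t₅`. The image is periodic, so `t₁t₂t₃`, with margins `t₀`
    -- and `t₄`, is recognized again one period further on; this forces `t₁ = t₂ = t₃`.
    have hm : (v ++ v) ++ ((v ++ v) ++ ((v ++ v) ++ ((v ++ v) ++ ((v ++ v) ++ (v ++ v))))) ∈
        blocks X := by
      refine mem_of_syntacticClass_eq hM ?_ hy
      simp [syntacticClass_append, hv0, e, hi]
    obtain ⟨z, hz, ez⟩ := hmap _ hm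
    obtain ⟨t₀, z₁, rfl, h₀, ez⟩ := List.map_eq_append_iff.1 ez
    obtain ⟨t₁, z₂, rfl, h₁, ez⟩ := List.map_eq_append_iff.1 ez
    obtain ⟨t₂, z₃, rfl, h₂, ez⟩ := List.map_eq_append_iff.1 ez
    obtain ⟨t₃, z₄, rfl, h₃, ez⟩ := List.map_eq_append_iff.1 ez
    obtain ⟨t₄, t₅, rfl, h₄, h₅⟩ := List.map_eq_append_iff.1 ez
    have l₀ := congrArg List.length h₀
    have l₁ := congrArg List.length h₁
    have l₂ := congrArg List.length h₂
    have l₃ := congrArg List.length h₃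
    have l₄ := congrArg List.length h₄
    simp only [List.length_map, List.length_append] at l₀ l₁ l₂ l₃ l₄
    have hr : Recognizes (blocks Z) (fun c => [f c]) t₀ (t₁ ++ t₂ ++ t₃) t₄ := by
      refine recognizes_letterMap hk ?_ (by omega) (by omega)
      refine (isFactorial_blocks Z).mem_of_append (x := []) (y := t₅) (by simpa using hz) ?_
      rw [← List.length_pos_iff]
      have := List.length_pos_of_ne_nil hv0
      simp only [List.length_append]
      omega
    obtain ⟨a', b', e', ha', -⟩ := hr _ hz (v ++ v) [] (by
      simp only [flatMap_singleton_eq_map, List.map_append, h₀, h₁, h₂, h₃, h₄, h₅,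
        List.append_assoc, List.append_nil])
    have la := congrArg List.length ha'
    simp only [flatMap_singleton_eq_map, List.length_map, List.length_append] at la
    have e₁ : (t₀ ++ t₁) ++ (t₂ ++ (t₃ ++ (t₄ ++ t₅))) = a' ++ (t₁ ++ (t₂ ++ (t₃ ++ b'))) := by
      simpa only [List.append_assoc] using e'
    have e₂ := (List.append_inj e₁ (by simp only [List.length_append]; omega)).2
    obtain ⟨rfl, e₃⟩ := List.append_inj e₂ (by omega)
    obtain ⟨rfl, -⟩ := List.append_inj e₃ (by omega)
    -- The period is `vv` rather than `v` so that it splits into two nonempty halves.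
    refine ⟨v, v, t₃, hv0, hv0, ?_, by rw [flatMap_singleton_eq_map, h₁], by omega, ?_⟩
    · rw [syntacticClass_append hv0 hv0, e, hi]
    · refine (isFactorial_blocks Z).mem_of_append (x := t₀) (y := t₄ ++ t₅)
        (by simpa only [List.append_assoc] using hz) ?_
      rw [← List.length_pos_iff]
      have := List.length_pos_of_ne_nil hv0
      simp only [List.length_append]
      omega

end LetterMaps

/-! ### Invariance under conjugacy. -/

namespace Shift

theorem translate_mem (X : Shift.{u}) {x : ℤ → X.Alphabet} (hx : x ∈ X.toSubshift.carrier) (n : ℤ) :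
    (fun i => x (i + n)) ∈ X.toSubshift.carrier := by
  have e : (fun i : ℤ => x (i + n)) = shift n x := by
    funext i
    rw [shift_apply, add_comm]
  rw [e]
  exact X.toSubshift.mapsTo n hx

theorem isCompact_carrier (X : Shift.{u}) : IsCompact X.toSubshift.carrier :=
  X.toSubshift.isClosed.isCompact

theorem nonempty_equivalence_of_conjugate {X Y : Shift.{u}} (h : Conjugate X Y) :
    Nonempty (X.karoubi ≌ Y.karoubi) := by
  obtain ⟨Φ, hΦ⟩ := h
  -- The range of `g` is the graph of the conjugacy, which recovers either shift by forgetting one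
  -- coordinate.
  let g : X.Point → ℤ → X.Alphabet × Y.Alphabet := fun p i => (p.1 i, (Φ p).1 i)
  have hg : Continuous g := continuous_pi fun i =>
    ((continuous_apply i).comp continuous_subtype_val).prodMk
      ((continuous_apply i).comp (continuous_subtype_val.comp Φ.continuous))
  have : CompactSpace X.Point := isCompact_iff_compactSpace.1 X.isCompact_carrier
  have hZ : IsCompact (Set.range g) := isCompact_range hg
  have hs1 : ∀ p, (fun i => g p (i + 1)) = g (X.map p) := by
    intro p
    simp only [g, hΦ]
    rfl
  have hs2 : ∀ p, ∃ q, X.map q = p := by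
    intro p
    refine ⟨⟨_, X.translate_mem p.2 (-1)⟩, Subtype.ext (funext fun i => ?_)⟩
    simp [map]
  have hs : ∀ z ∈ Set.range g, ∀ n : ℤ, (fun i => z (i + n)) ∈ Set.range g := by
    intro z hz n
    induction n with
    | zero => simpa using hz
    | succ n ih =>
      obtain ⟨p, hp⟩ := ih
      refine ⟨X.map p, ?_⟩
      rw [← hs1, hp]
      funext i
      ring_nf
    | pred n ih =>
      obtain ⟨p, hp⟩ := ih
      obtain ⟨q, rfl⟩ := hs2 p
      refine ⟨q, funext fun i => ?_⟩
      rw [← hs1] at hp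
      have := congrFun hp (i - 1)
      simp only [sub_add_cancel] at this
      rw [this]
      ring_nf
  obtain ⟨k, hk⟩ := exists_window hZ hs (f := Prod.fst) (by
    rintro _ ⟨p, rfl⟩ _ ⟨q, rfl⟩ e
    exact congrArg g (Subtype.ext e))
  obtain ⟨k', hk'⟩ := exists_window hZ hs (f := Prod.snd) (by
    rintro _ ⟨p, rfl⟩ _ ⟨q, rfl⟩ e
    exact congrArg g (Φ.injective (Subtype.ext e)))
  obtain ⟨E⟩ := (isRecognizable_letterMap hk (X := X.toSubshift.carrier) (by
    ext x
    constructor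
    · exact fun hx => ⟨_, ⟨⟨x, hx⟩, rfl⟩, rfl⟩
    · rintro ⟨_, ⟨p, rfl⟩, rfl⟩
      exact p.2)).nonempty_equivalence
  obtain ⟨E'⟩ := (isRecognizable_letterMap hk' (X := Y.toSubshift.carrier) (by
    ext y
    constructor
    · refine fun hy => ⟨_, ⟨Φ.symm ⟨y, hy⟩, rfl⟩, ?_⟩
      funext i
      simp [g]
    · rintro ⟨_, ⟨p, rfl⟩, rfl⟩
      exact (Φ p).2)).nonempty_equivalence
  exact ⟨E.symm.trans E'⟩

end Shift

/-! ### The subshift defined by a factorial prolongable language. -/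

section SubshiftOfLanguage

variable {B : Type u} {F : Language B}

theorem block_mem_of_le (hF : IsFactorial F) {x : ℤ → B} {i j : ℤ} {m n : ℕ} (h : block x i n ∈ F)
    (hij : i ≤ j) (hjm : j + m ≤ i + n) (hm : m ≠ 0) : block x j m ∈ F := by
  obtain ⟨a, rfl⟩ := Int.le.dest hij
  obtain ⟨b, hb⟩ := Int.le.dest hjm
  have hn : n = a + m + b := by omega
  rw [hn, block_add, block_add] at h
  refine hF.mem_of_append h ?_
  rw [← List.length_pos_iff, length_block]
  omega

variable [TopologicalSpace B] [DiscreteTopology B]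

theorem isClosed_setOf_block_mem (i : ℤ) (n : ℕ) (s : Set (List B)) :
    IsClosed {x : ℤ → B | block x i n ∈ s} := by
  have h (x : ℤ → B) : block x i n = List.ofFn fun k : Fin n => x (i + (k : ℕ)) := by
    refine List.ext_getElem (by simp) fun m h₁ h₂ => ?_
    simp [block]
  simp only [h]
  exact (isClosed_discrete {g : Fin n → B | List.ofFn g ∈ s}).preimage
    (f := fun (x : ℤ → B) (k : Fin n) => x (i + (k : ℕ))) (by fun_prop)

/-- A factorial prolongable language over a finite alphabet consists of blocks of sequences all of
whose blocks belong to it. -/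
theorem exists_sequence_of_mem [Finite B] (hF : IsFactorial F) (hp : IsProlongable F) {w : List B}
    (hw : w ∈ F) :
    ∃ x : ℤ → B, block x 0 w.length = w ∧ ∀ i n, n ≠ 0 → block x i n ∈ F := by
  have hw0 := List.length_pos_of_ne_nil (hF.ne_nil hw)
  let K : ℕ → Set (ℤ → B) := fun n =>
    {x | block x 0 w.length ∈ ({w} : Set (List B))} ∩ {x | block x (-n) (n + w.length + n) ∈ F}
  have hK (n : ℕ) : IsClosed (K n) :=
    (isClosed_setOf_block_mem _ _ _).inter (isClosed_setOf_block_mem _ _ F)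
  obtain ⟨x, hx⟩ := IsCompact.nonempty_iInter_of_sequence_nonempty_isCompact_isClosed K
    (fun n x hx => ⟨hx.1, block_mem_of_le hF hx.2 (by push_cast; omega) (by push_cast; omega)
      (by omega)⟩)
    (fun n => by
      obtain ⟨p, q, hpn, hqn, h⟩ := hp w hw n
      -- `w` is placed at index `0`; the values outside `pwq` do not matter, since `K n` only
      -- constrains a block inside it.
      let x : ℤ → B := fun i => (p ++ w ++ q).getD (i + p.length).toNat (w.head (hF.ne_nil hw))
      have hx : block x (-p.length) (p ++ w ++ q).length = p ++ w ++ q := by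
        refine List.ext_getElem (by simp) fun m h₁ h₂ => ?_
        simp only [block, List.getElem_map, List.getElem_range, x]
        have hm : (-(p.length : ℤ) + m + p.length).toNat = m := by omega
        rw [hm, List.getD_eq_getElem _ _ h₂]
      refine ⟨x, ?_, block_mem_of_le hF (hx.symm ▸ h) (by omega) ?_ (by omega)⟩
      · have := (eq_block_of_append_eq (eq_block_of_append_eq hx.symm).1).2
        rw [neg_add_cancel] at this
        exact this.symm
      · simp only [List.length_append]
        push_cast
        omega)
    (hK 0).isCompact hK
  rw [Set.mem_iInter] at hx
  refine ⟨x, (hx 0).1, fun i n hn => block_mem_of_le hF (hx (i.natAbs + n)).2 ?_ ?_ hn⟩ <;> omega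

/-- The subshift of the sequences all of whose blocks belong to a language. -/
def subshiftOfLanguage (F : Language B) : Subshift B ℤ where
  carrier := {x | ∀ i n, n ≠ 0 → block x i n ∈ F}
  isClosed := by
    simp only [Set.ofPred_forall]
    exact isClosed_iInter fun i => isClosed_iInter fun n => isClosed_iInter fun _ =>
      isClosed_setOf_block_mem i n F
  mapsTo g x hx i n hn := by
    have : block (shift g x) i n = block x (g + i) n := by
      simp only [block, shift_apply, add_assoc]
    rw [this]
    exact hx _ _ hn

theorem mem_blocks_subshiftOfLanguage [Finite B] (hF : IsFactorial F) (hp : IsProlongable F)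
    {w : List B} (hw : w ∈ F) : w ∈ blocks (subshiftOfLanguage F).carrier := by
  obtain ⟨x, hx, h⟩ := exists_sequence_of_mem hF hp hw
  exact mem_blocks.2 ⟨hF.ne_nil hw, x, h, 0, hx.symm⟩

end SubshiftOfLanguage

/-! ### Desubstitution for the symbol expansion. -/

section Expansion

variable {A B : Type u} {e : Option A ≃ B} {α : A}

open Classical in
/-- The image of a letter under the symbol expansion. -/
noncomputable def expandLetter (e : Option A ≃ B) (α a : A) : List B :=
  if a = α then [e (some a), e none] else [e (some a)]

theorem expandLetter_eq (a : A) : expandLetter e α a = [e (some a), e none] ∨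
    expandLetter e α a = [e (some a)] := by
  rw [expandLetter]
  split_ifs <;> simp

theorem flatMap_expandLetter_ne_cons (z : List A) (R : List B) :
    z.flatMap (expandLetter e α) ≠ e none :: R := by
  cases z with
  | nil => simp
  | cons a z => rcases expandLetter_eq (e := e) (α := α) a with h | h <;> simp [h]

/-- The new letter occurs only as the second letter of an image, so two of them are never adjacent.
-/
theorem flatMap_expandLetter_ne_append (z : List A) (P R : List B) :
    z.flatMap (expandLetter e α) ≠ P ++ e none :: e none :: R := by
  induction z generalizing P with
  | nil => simp
  | cons a z ih =>
    intro h
    rcases P with _ | ⟨c, P⟩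
    · exact flatMap_expandLetter_ne_cons _ _ h
    rcases expandLetter_eq (e := e) (α := α) a with h' | h' <;>
      simp only [List.flatMap_cons, h', List.cons_append, List.nil_append, List.cons.injEq] at h
    · rcases P with _ | ⟨c', P⟩
      · exact flatMap_expandLetter_ne_cons _ _ (List.cons.inj h.2).2
      · exact ih P (List.cons.inj h.2).2
    · exact ih P h.2

/-- A letter other than the new one always begins the image of a letter, so a boundary of the
substitution lies just before it. -/
theorem exists_cut {z : List A} {P R : List B} {b : B}
    (h : z.flatMap (expandLetter e α) = P ++ b :: R) (hb : b ≠ e none) :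
    ∃ z₁ z₂, z = z₁ ++ z₂ ∧ z₁.flatMap (expandLetter e α) = P ∧
      z₂.flatMap (expandLetter e α) = b :: R := by
  induction z generalizing P with
  | nil => simp at h
  | cons a z ih =>
    rcases P with _ | ⟨c, P⟩
    · exact ⟨[], a :: z, rfl, rfl, h⟩
    rcases expandLetter_eq (e := e) (α := α) a with h' | h' <;>
      simp only [List.flatMap_cons, h', List.cons_append, List.nil_append, List.cons.injEq] at h
    · rcases P with _ | ⟨c', P⟩
      · exact absurd (List.cons.inj h.2).1.symm hb
      · obtain ⟨z₁, z₂, rfl, h₁, h₂⟩ := ih (List.cons.inj h.2).2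
        exact ⟨a :: z₁, z₂, rfl, by simp [h', h₁, h.1, (List.cons.inj h.2).1], h₂⟩
    · obtain ⟨z₁, z₂, rfl, h₁, h₂⟩ := ih h.2
      exact ⟨a :: z₁, z₂, rfl, by simp [h', h₁, h.1], h₂⟩

theorem flatMap_expandLetter_injective :
    Function.Injective fun z : List A => z.flatMap (expandLetter e α) := by
  intro z
  induction z with
  | nil =>
    rintro (_ | ⟨a, z⟩) h
    · rfl
    · rcases expandLetter_eq (e := e) (α := α) a with h' | h' <;> simp [h'] at h
  | cons a z ih =>
    rintro (_ | ⟨a', z'⟩) h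
    · rcases expandLetter_eq (e := e) (α := α) a with h' | h' <;> simp [h'] at h
    · obtain rfl : a = a' := by
        rcases expandLetter_eq (e := e) (α := α) a with h' | h' <;>
          rcases expandLetter_eq (e := e) (α := α) a' with h'' | h'' <;>
          simp only [List.flatMap_cons, h', h'', List.cons_append, List.cons.injEq] at h <;>
          exact Option.some.inj (e.injective h.1)
      simp only [List.flatMap_cons, List.append_cancel_left_eq] at h
      rw [ih h]

theorem exists_cons_eq_flatMap_expandLetter {z : List A} (hz : z ≠ []) :
    ∃ b R, b ≠ e none ∧ z.flatMap (expandLetter e α) = b :: R := by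
  cases z with
  | nil => exact absurd rfl hz
  | cons a z =>
    rcases expandLetter_eq (e := e) (α := α) a with h | h <;>
      exact ⟨e (some a), _, by simp, by rw [List.flatMap_cons, h]; rfl⟩

/-- The first letters of the images of `wb` and of `b` mark the two ends of `w`, and injectivity
identifies the word between them. No left margin is needed. -/
theorem recognizes_expandLetter (L : Language A) (a w : List A) {b : List A} (hb : b ≠ []) :
    Recognizes L (expandLetter e α) a w b := by
  intro z _ P Q h
  obtain ⟨c, R, hc, hR⟩ := exists_cons_eq_flatMap_expandLetter (e := e) (α := α)
    (z := w ++ b) (by simp [hb])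
  obtain ⟨c', R', hc', hR'⟩ := exists_cons_eq_flatMap_expandLetter (e := e) (α := α) hb
  obtain ⟨z₁, z₂, rfl, h₁, h₂⟩ := exists_cut (P := P ++ a.flatMap (expandLetter e α)) (b := c)
    (R := R ++ Q) (by
      rw [h, ← List.cons_append, ← hR]
      simp only [List.flatMap_append, List.append_assoc]) hc
  obtain ⟨z₃, z₄, rfl, h₃, h₄⟩ := exists_cut (P := w.flatMap (expandLetter e α)) (b := c')
    (R := R' ++ Q) (by
      rw [h₂, ← List.cons_append, ← hR, ← List.cons_append, ← hR']
      simp only [List.flatMap_append, List.append_assoc]) hc'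
  obtain rfl : z₃ = w := flatMap_expandLetter_injective h₃
  exact ⟨z₁, z₄, by rw [List.append_assoc], h₁, by rw [h₄, ← List.cons_append, ← hR']⟩

theorem exists_cube_mem {L : Language A} (hL : IsFactorial L) {z : List A} (hz : z ∈ L)
    {P s Q : List B} {b c : B} (hb : b ≠ e none) (hc : c ≠ e none)
    (h : z.flatMap (expandLetter e α) = P ++ ((b :: s) ++ (b :: s) ++ (b :: s)) ++ c :: Q) :
    ∃ t, t.flatMap (expandLetter e α) = b :: s ∧ 1 ≤ t.length ∧ t ++ t ++ t ∈ L := by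
  obtain ⟨z₁, z₂, rfl, -, h₂⟩ := exists_cut (P := P) (b := b) (by simpa using h) hb
  obtain ⟨z₃, z₄, rfl, h₃, -⟩ := exists_cut (P := (b :: s) ++ (b :: s) ++ (b :: s)) (b := c)
    (R := Q) (by rw [h₂]; simp) hc
  obtain ⟨t, z₅, rfl, ht, h₅⟩ := exists_cut (P := b :: s) (b := b) (by simpa using h₃) hb
  have ht0 : t ≠ [] := by
    rintro rfl
    simp at ht
  -- Decoding the first period suffices: `ttt` has the same image as the whole decoded word.
  have hz₅ : t ++ z₅ = t ++ t ++ t := flatMap_expandLetter_injective (e := e) (α := α) (by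
    simp only [List.flatMap_append, ht, h₅]
    simp)
  refine ⟨t, ht, List.length_pos_of_ne_nil ht0, hz₅ ▸ hL.mem_of_append (x := z₁) (y := z₄) ?_ ?_⟩
  · simpa only [List.append_assoc] using hz
  · simp [ht0]

/-- The language of the non-empty factors of images of words under the symbol expansion. -/
def expandedLanguage (e : Option A ≃ B) (α : A) (L : Language A) : Language B :=
  {w | w ≠ [] ∧ ∃ z ∈ L, ∃ P Q, z.flatMap (expandLetter e α) = P ++ w ++ Q}

theorem isFactorial_expandedLanguage (L : Language A) : IsFactorial (expandedLanguage e α L) where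
  nil_notMem h := h.1 rfl
  mem_of_append {x w y} h h0 := by
    obtain ⟨-, z, hz, P, Q, e⟩ := h
    exact ⟨h0, z, hz, P ++ x, y ++ Q, by rw [e]; simp only [List.append_assoc]⟩

theorem length_le_length_flatMap_expandLetter (z : List A) :
    z.length ≤ (z.flatMap (expandLetter e α)).length := by
  induction z with
  | nil => simp
  | cons a z ih =>
    rcases expandLetter_eq (e := e) (α := α) a with h | h <;>
      simp only [List.flatMap_cons, h, List.length_append, List.length_cons, List.length_nil] <;>
      omega

theorem isProlongable_expandedLanguage {L : Language A} (hL : IsProlongable L) :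
    IsProlongable (expandedLanguage e α L) := by
  rintro w ⟨hw, z, hz, P, Q, h⟩ n
  obtain ⟨p, q, hp, hq, hm⟩ := hL z hz n
  refine ⟨p.flatMap (expandLetter e α) ++ P, Q ++ q.flatMap (expandLetter e α), ?_, ?_,
    by simp [hw], _, hm, [], [], ?_⟩
  · have := length_le_length_flatMap_expandLetter (e := e) (α := α) p
    rw [List.length_append]
    omega
  · have := length_le_length_flatMap_expandLetter (e := e) (α := α) q
    rw [List.length_append]
    omega
  · simp only [List.flatMap_append, h, List.append_assoc, List.append_nil, List.nil_append]

theorem isRecognizable_expandLetter {L : Language A} {M : Language B} (hL : IsFactorial L)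
    (hL' : IsProlongable L) (hM : IsFactorial M)
    (hmap : ∀ w ∈ L, w.flatMap (expandLetter e α) ∈ M) (hfac : ∀ w ∈ M, w ∈ expandedLanguage e α L) :
    IsRecognizable L M (expandLetter e α) 1 := by
  refine ⟨fun a => ?_, hL, hL', hM, hmap, fun w hw => (hfac w hw).2, ?_, ?_⟩
  · rcases expandLetter_eq (e := e) (α := α) a with h | h <;> simp [h]
  · exact fun a w b _ _ hb => recognizes_expandLetter L a w (List.ne_nil_of_length_pos hb)
  · intro y hy hi
    have hy0 := hM.ne_nil hy
    have hm : (y ++ y) ++ (y ++ y) ++ (y ++ y) ++ y ∈ M := by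
      refine mem_of_syntacticClass_eq hM ?_ hy
      simp [syntacticClass_append, hy0, hi]
    obtain ⟨-, z, hz, P, Q, h⟩ := hfac _ hm
    obtain ⟨c, y', rfl⟩ := List.exists_cons_of_ne_nil hy0
    -- If `y` begins with the new letter, moving that letter to the end gives a rotation starting at
    -- a cut. Otherwise `y` itself starts at a cut, and `yy` serves as period so that both halves
    -- are nonempty. In both cases the seven copies leave a letter after three periods to mark the
    -- final cut.
    by_cases hc : c = e none
    · subst hc
      rcases y' with _ | ⟨c, y'⟩
      · exact absurd (by simpa using h) (flatMap_expandLetter_ne_append (e := e) (α := α) z P _)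
      have hc : c ≠ e none := by
        rintro rfl
        exact flatMap_expandLetter_ne_append (e := e) (α := α) z P _ (by simpa using h)
      obtain ⟨t, ht, hl, htm⟩ := exists_cube_mem hL hz (P := P ++ [e none])
        (s := y' ++ [e none]) hc hc (by simpa using h)
      exact ⟨[e none], c :: y', t, by simp, by simp, rfl, ht, hl, htm⟩
    · obtain ⟨t, ht, hl, htm⟩ := exists_cube_mem hL hz (P := P) (s := y' ++ c :: y') hc hc
        (by simpa using h)
      refine ⟨c :: y', c :: y', t, by simp, by simp, ?_, ht, hl, htm⟩
      rw [syntacticClass_append (by simp) (by simp), hi]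

end Expansion

/-! ### Invariance under symbol expansion and flow equivalence. -/

namespace Shift

theorem nonempty_equivalence_of_isSymbolExpansion {X Y : Shift.{u}} (h : IsSymbolExpansion X Y) :
    Nonempty (X.karoubi ≌ Y.karoubi) := by
  obtain ⟨e, α, hmap, hmin⟩ := h
  have hF := isFactorial_expandedLanguage (e := e) (α := α) X.language
  have hp := isProlongable_expandedLanguage (e := e) (α := α)
    (isProlongable_blocks X.toSubshift.carrier)
  -- Minimality is tested against the subshift of sequences whose blocks are factors of expanded
  -- words; hence every block of `Y` is such a factor.
  have hsub := hmin (subshiftOfLanguage (expandedLanguage e α X.language)) fun l hl =>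
    mem_blocks_subshiftOfLanguage hF hp ⟨(isFactorial_blocks _).ne_nil (hmap l hl), l, hl, [], [],
      by rw [List.nil_append, List.append_nil]; rfl⟩
  refine (isRecognizable_expandLetter (e := e) (α := α) (isFactorial_blocks _)
    (isProlongable_blocks _) (isFactorial_blocks _) hmap fun w hw => ?_).nonempty_equivalence
  obtain ⟨hw0, x, hx, i, h⟩ := mem_blocks.1 hw
  rw [h]
  exact hsub hx i _ (List.length_pos_of_ne_nil hw0).ne'

theorem FlowEquivalent.nonempty_equivalence {X Y : Shift.{u}} (h : X.FlowEquivalent Y) :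
    Nonempty (X.karoubi ≌ Y.karoubi) := by
  induction h with
  | rel X Y h =>
    exact h.elim nonempty_equivalence_of_conjugate nonempty_equivalence_of_isSymbolExpansion
  | refl X => exact ⟨.refl⟩
  | symm X Y _ ih => exact ih.map fun E => E.symm
  | trans X Y Z _ _ ih₁ ih₂ => exact ih₁.elim fun E₁ => ih₂.map fun E₂ => E₁.trans E₂

end Shift

end KaroubiShift

theorem mainTheorem1 (X Y : KaroubiShift.Shift.{u}) (h : X.FlowEquivalent Y) :
    Nonempty (X.karoubi ≌ Y.karoubi) ∧
    KaroubiShift.MoritaEquivalentUpToLocalUnits X.syntacticSemigroup Y.syntacticSemigroup ∧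
    ∀ (C : Type v) [Category.{w} C] (F : (S : Type u) → [Semigroup S] → C),
      KaroubiShift.IsKaroubiInvariant F →
        Nonempty (F X.syntacticSemigroup ≅ F Y.syntacticSemigroup) :=
  ⟨h.nonempty_equivalence, h.nonempty_equivalence, fun _ _ _ hF => hF _ _ h.nonempty_equivalence⟩
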